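/- For every positive integer $k$ there are constants $g_1(k)$, $g_2(k)$ and $N(k)$, depending only on $k$, such that the following holds. Let $G$ be a finite simple graph on $n \ge N(k)$ vertices with maximum degree $\Delta$. Then $G$ has an induced subgraph $H$ on at least $n - g_1(k)\sqrt{\Delta}$ vertices in which some $k$ distinct vertices all have the same degree $d$ (in $H$), where $d \ge \Delta(H) - g_2(k)$ and $\Delta(H)$ denotes the maximum degree of $H$. -/

import Mathlib

universe u

/-! To equalize degrees of fixed vertices `w a`, sort the other vertices by adjacency type to the `w
a`. Dickson's lemma finds a bounded set whose deletion increases no pairwise difference and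
decreases one, so the total deletion is linear in the differences (`exists_equalizing_deletion`).

The square root comes from cutting the degree range into about √Δ layers of width about √Δ: removing
sparse top layers leaves many vertices within O(√Δ) of the maximum (`exists_clustered_top_degrees`).
These are reserves. A family within O(1) of the maximum starts from one maximum vertex and grows by
equalizing it with a reserve. Either this succeeds, or an outside vertex first comes within O(1) of
the family and joins it instead (`exists_enlarged_near_max_family`).

When the family is large, Ramsey gives a clique or independent `k`-set in it. Its internal degrees
already agree, and O(1) outside deletions equalize the rest. -/

/-! ### Bounded unbalanced parts via Dickson's lemma -/

/-- In a well-quasi-order, every element of `Q` dominates one of finitely many elements of `Q`. -/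
lemma exists_bounded_le_of_wellQuasiOrdered {α : Type*} [PartialOrder α] [WellQuasiOrderedLE α]
    (Q : Set α) (f : α → ℕ) : ∃ C, ∀ x ∈ Q, ∃ y ∈ Q, y ≤ x ∧ f y ≤ C := by
  have hfin : {x | Minimal (· ∈ Q) x}.Finite :=
    WellQuasiOrderedLE.finite_of_isAntichain (setOfPred_minimal_antichain _)
  obtain ⟨C, hC⟩ := (hfin.image f).bddAbove
  refine ⟨C, fun x hx => ?_⟩
  obtain ⟨y, hyx, hy⟩ := (Set.isPWO_of_wellQuasiOrderedLE Q).exists_le_minimal hx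
  exact ⟨y, hy.1, hyx, hC ⟨y, hy, rfl⟩⟩

/-- A nonbalanced integer combination of `0/1`-vectors contains a bounded nonbalanced part whose
coordinate differences have the same signs as those of the whole and are no larger. -/
lemma exists_bounded_unbalanced_part (ι : Type*) [Fintype ι] [DecidableEq ι] :
    ∃ C, ∀ m : Finset ι → ℕ,
      (∃ a b, ∑ t with a ∈ t, m t ≠ ∑ t with b ∈ t, m t) →
      ∃ m' : Finset ι → ℕ, m' ≤ m ∧ ∑ t, m' t ≤ C ∧
        (∀ a b, ∑ t with a ∈ t, m' t - ∑ t with b ∈ t, m' t ≤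
          ∑ t with a ∈ t, m t - ∑ t with b ∈ t, m t) ∧
        ∃ a b, ∑ t with a ∈ t, m' t ≠ ∑ t with b ∈ t, m' t := by
  -- The second coordinate carries the truncated differences. For the whole, one of the entries `(a,
  -- b)`, `(b, a)` vanishes; domination forces the same for the part, so its signs agree.
  obtain ⟨C, hC⟩ := exists_bounded_le_of_wellQuasiOrdered
    {x : (Finset ι → ℕ) × (ι × ι → ℕ) | (∀ a b, ∑ t with a ∈ t, x.1 t + x.2 (b, a) =
      ∑ t with b ∈ t, x.1 t + x.2 (a, b)) ∧ ∃ a b, x.2 (a, b) ≠ 0} (fun x => ∑ t, x.1 t)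
  refine ⟨C, fun m ⟨a₀, b₀, hab⟩ => ?_⟩
  obtain ⟨⟨m', f'⟩, ⟨h1, a, b, h2⟩, hle, hb⟩ := hC (m, fun p => ∑ t with p.1 ∈ t, m t -
      ∑ t with p.2 ∈ t, m t) (by
    refine ⟨fun a b => by dsimp only; omega, ?_⟩
    rcases lt_or_gt_of_ne hab with h | h
    · exact ⟨b₀, a₀, by dsimp only; omega⟩
    · exact ⟨a₀, b₀, by dsimp only; omega⟩)
  have hf : ∀ a b, f' (a, b) ≤ ∑ t with a ∈ t, m t - ∑ t with b ∈ t, m t :=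
    fun a b => hle.2 (a, b)
  dsimp only at h1 h2 hb
  refine ⟨m', hle.1, hb, fun a b => ?_, a, b, ?_⟩
  · have := h1 a b; have := hf a b; have := hf b a; omega
  · have := h1 a b; have := hf a b; have := hf b a; omega

/-! ### Degrees into a vertex set -/

open Classical in
/-- The number of neighbours of `v` in `S`. -/
noncomputable def degreeInto {V : Type u} (G : SimpleGraph V) (S : Finset V) (v : V) : ℕ :=
  (S.filter (G.Adj v)).card

section degreeInto

variable {V : Type u} (G : SimpleGraph V)

lemma degreeInto_le_card (S : Finset V) (v : V) : degreeInto G S v ≤ S.card := by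
  classical
  exact Finset.card_filter_le _ _

lemma degreeInto_mono {S T : Finset V} (h : S ⊆ T) (v : V) :
    degreeInto G S v ≤ degreeInto G T v := by
  classical
  unfold degreeInto
  exact Finset.card_le_card (Finset.filter_subset_filter _ h)

lemma degreeInto_union [DecidableEq V] {S T : Finset V} (h : Disjoint S T) (v : V) :
    degreeInto G (S ∪ T) v = degreeInto G S v + degreeInto G T v := by
  classical
  unfold degreeInto
  rw [← Finset.card_union_of_disjoint (Finset.disjoint_filter_filter h), ← Finset.filter_union]

lemma degreeInto_sdiff [DecidableEq V] {S B : Finset V} (h : B ⊆ S) (v : V) :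
    degreeInto G (S \ B) v + degreeInto G B v = degreeInto G S v := by
  rw [← degreeInto_union G Finset.sdiff_disjoint, Finset.sdiff_union_of_subset h]

lemma degreeInto_le_sdiff_add [DecidableEq V] (S S' : Finset V) (v : V) :
    degreeInto G S v ≤ degreeInto G S' v + (S \ S').card := by
  calc degreeInto G S v ≤ degreeInto G (S' ∪ (S \ S')) v :=
        degreeInto_mono G (by rw [Finset.union_sdiff_self_eq_union]; exact Finset.subset_union_right) v
    _ = degreeInto G S' v + degreeInto G (S \ S') v := degreeInto_union G Finset.disjoint_sdiff v
    _ ≤ _ := by gcongr; exact degreeInto_le_card _ _ _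

end degreeInto

/-! ### Equalizing degrees by deletion -/

/-- If the vertices `w a` do not all have the same degree into `U`, a bounded subset of `U`
accounts for a part of the differences. -/
lemma exists_bounded_degree_unbalanced (r : ℕ) : ∃ C, ∀ (V : Type u) (G : SimpleGraph V)
    (U : Finset V) (w : Fin r → V), (∃ a b, degreeInto G U (w a) ≠ degreeInto G U (w b)) →
    ∃ B ⊆ U, B.card ≤ C ∧
      (∀ a b, degreeInto G B (w a) - degreeInto G B (w b) ≤
        degreeInto G U (w a) - degreeInto G U (w b)) ∧
      ∃ a b, degreeInto G B (w a) ≠ degreeInto G B (w b) := by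
  obtain ⟨C, hC⟩ := exists_bounded_unbalanced_part (Fin r)
  refine ⟨C, fun V G U w => ?_⟩
  classical
  let ty : V → Finset (Fin r) := fun u => Finset.univ.filter fun a => G.Adj (w a) u
  have key : ∀ (B : Finset V) (a : Fin r), degreeInto G B (w a) =
      ∑ t with a ∈ t, (B.filter fun u => ty u = t).card := by
    intro B a
    unfold degreeInto
    rw [Finset.card_eq_sum_card_fiberwise (f := ty) (t := Finset.univ.filter fun t => a ∈ t)
      (fun u hu => by simp at hu; simp [ty, hu.2])]
    refine Finset.sum_congr rfl fun t ht => ?_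
    congr 1
    ext u
    simp only [Finset.mem_filter, Finset.mem_univ, true_and] at ht ⊢
    constructor
    · rintro ⟨⟨h, _⟩, h'⟩; exact ⟨h, h'⟩
    · rintro ⟨h, rfl⟩; exact ⟨⟨h, by simpa [ty] using ht⟩, rfl⟩
  intro hne
  simp only [key] at hne
  obtain ⟨m', hle, hb, hs, hne'⟩ := hC _ hne
  choose b hbU hbc using fun t => Finset.exists_subset_card_eq (hle t)
  have hfib : ∀ t, ((Finset.univ.biUnion b).filter fun u => ty u = t) = b t := by
    intro t
    ext u
    simp only [Finset.mem_filter, Finset.mem_biUnion, Finset.mem_univ, true_and]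
    constructor
    · rintro ⟨⟨t', h⟩, rfl⟩
      have := Finset.mem_filter.1 (hbU t' h)
      rwa [this.2]
    · intro h
      exact ⟨⟨t, h⟩, (Finset.mem_filter.1 (hbU t h)).2⟩
  refine ⟨Finset.univ.biUnion b, ?_, ?_, ?_, ?_⟩
  · exact Finset.biUnion_subset.2 fun t _ => (hbU t).trans (Finset.filter_subset _ _)
  · refine Finset.card_biUnion_le.trans ?_
    simpa only [hbc] using hb
  · simpa only [key, hfib, hbc] using hs
  · simpa only [key, hfib, hbc] using hne'

/-- Repeatedly deleting bounded sets that shrink all degree differences, until either the `w a`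
have equal degrees or a stopping condition is met. -/
lemma exists_equalizing_deletion (r : ℕ) : ∃ C, ∀ (V : Type u) [DecidableEq V] (G : SimpleGraph V)
    (w : Fin r → V) (Inv Goal : Finset V → Prop),
    (∀ U, Inv U → (∀ a b, degreeInto G U (w a) = degreeInto G U (w b)) → Goal U) →
    (∀ U B, B ⊆ U → B.card ≤ C → Inv U →
      (∀ a b, degreeInto G (U \ B) (w a) - degreeInto G (U \ B) (w b) ≤
        degreeInto G U (w a) - degreeInto G U (w b)) → Goal U ∨ Inv (U \ B)) →
    ∀ U, Inv U → ∃ U' ⊆ U, Goal U' ∧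
      (U \ U').card ≤ C * ∑ p : Fin r × Fin r,
        (degreeInto G U (w p.1) - degreeInto G U (w p.2)) := by
  obtain ⟨C, hC⟩ := exists_bounded_degree_unbalanced r
  refine ⟨C, fun V _ G w Inv Goal hend hstep U => ?_⟩
  induction hn : ∑ p : Fin r × Fin r, (degreeInto G U (w p.1) - degreeInto G U (w p.2))
    using Nat.strong_induction_on generalizing U with
  | _ n ih =>
  intro hU
  by_cases heq : ∀ a b, degreeInto G U (w a) = degreeInto G U (w b)
  · exact ⟨U, subset_rfl, hend U hU heq, by simp⟩
  push Not at heq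
  obtain ⟨B, hBU, hBC, hs, a, b, hab⟩ := hC V G U w heq
  have hd := fun a => degreeInto_sdiff G hBU (w a)
  -- Differences in `B` have the signs of those in `U` and are no larger, so deleting `B` never
  -- overshoots. The sum is a potential that drops in each round of at most `C` deletions.
  have hle : ∀ a b, degreeInto G (U \ B) (w a) - degreeInto G (U \ B) (w b) ≤
        degreeInto G U (w a) - degreeInto G U (w b) := by
    intro a b
    have := hs a b; have := hs b a; have := hd a; have := hd b
    omega
  rcases hstep U B hBU hBC hU hle with h | h
  · exact ⟨U, subset_rfl, h, by simp⟩
  have hlt : ∑ p : Fin r × Fin r,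
      (degreeInto G (U \ B) (w p.1) - degreeInto G (U \ B) (w p.2)) < n := by
    rw [← hn]
    refine Finset.sum_lt_sum (fun p _ => hle _ _) ?_
    have := hs a b; have := hs b a; have := hd a; have := hd b
    rcases lt_or_gt_of_ne hab with h | h
    · exact ⟨(b, a), Finset.mem_univ _, by dsimp only; omega⟩
    · exact ⟨(a, b), Finset.mem_univ _, by dsimp only; omega⟩
  obtain ⟨U', hU', hG, hc⟩ := ih _ hlt (U \ B) rfl h
  refine ⟨U', hU'.trans Finset.sdiff_subset, hG, ?_⟩
  calc (U \ U').card ≤ (B ∪ ((U \ B) \ U')).card := Finset.card_le_card (by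
        intro x; simp only [Finset.mem_sdiff, Finset.mem_union]; tauto)
    _ ≤ B.card + ((U \ B) \ U').card := Finset.card_union_le _ _
    _ ≤ C + C * _ := add_le_add hBC hc
    _ = C * (_ + 1) := by ring
    _ ≤ C * n := Nat.mul_le_mul_left _ hlt

/-! ### Ramsey's theorem -/

/-- Ramsey's theorem for graphs. -/
lemma exists_clique_or_indep (a b : ℕ) : ∃ N, ∀ (V : Type u) (G : SimpleGraph V) (W : Finset V),
    N ≤ W.card → (∃ T ⊆ W, T.card = a ∧ ∀ x ∈ T, ∀ y ∈ T, x ≠ y → G.Adj x y) ∨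
      (∃ T ⊆ W, T.card = b ∧ ∀ x ∈ T, ∀ y ∈ T, ¬ G.Adj x y) := by
  classical
  induction a generalizing b with
  | zero => exact ⟨0, fun V G W _ => Or.inl ⟨∅, by simp⟩⟩
  | succ a iha =>
    induction b with
    | zero => exact ⟨0, fun V G W _ => Or.inr ⟨∅, by simp⟩⟩
    | succ b ihb =>
      obtain ⟨N₁, h₁⟩ := iha (b + 1)
      obtain ⟨N₂, h₂⟩ := ihb
      refine ⟨N₁ + N₂ + 1, fun V G W hW => ?_⟩
      obtain ⟨v, hv⟩ : W.Nonempty := Finset.card_pos.1 (by omega)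
      have hcard := Finset.card_filter_add_card_filter_not (s := W.erase v) (G.Adj v)
      rw [Finset.card_erase_of_mem hv] at hcard
      have hins : ∀ (T : Finset V) (n : ℕ), T ⊆ W.erase v → T.card = n →
          insert v T ⊆ W ∧ (insert v T).card = n + 1 := by
        intro T n hT hc
        refine ⟨Finset.insert_subset hv (hT.trans (Finset.erase_subset _ _)), ?_⟩
        rw [Finset.card_insert_of_notMem (fun h => by simpa using hT h), hc]
      by_cases hA : N₁ ≤ ((W.erase v).filter (G.Adj v)).card
      · rcases h₁ V G _ hA with ⟨T, hT, hc, hadj⟩ | ⟨T, hT, hc, hadj⟩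
        · left
          obtain ⟨h, h'⟩ := hins T a (hT.trans (Finset.filter_subset _ _)) hc
          refine ⟨_, h, h', ?_⟩
          intro x hx y hy hxy
          rcases Finset.mem_insert.1 hx with rfl | hx' <;>
            rcases Finset.mem_insert.1 hy with rfl | hy'
          · exact absurd rfl hxy
          · exact (Finset.mem_filter.1 (hT hy')).2
          · exact (Finset.mem_filter.1 (hT hx')).2.symm
          · exact hadj x hx' y hy' hxy
        · exact Or.inr ⟨T, hT.trans ((Finset.filter_subset _ _).trans (Finset.erase_subset _ _)),
            hc, hadj⟩
      · rcases h₂ V G ((W.erase v).filter fun u => ¬ G.Adj v u) (by omega) with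
          ⟨T, hT, hc, hadj⟩ | ⟨T, hT, hc, hadj⟩
        · exact Or.inl ⟨T, hT.trans ((Finset.filter_subset _ _).trans (Finset.erase_subset _ _)),
            hc, hadj⟩
        · right
          obtain ⟨h, h'⟩ := hins T b (hT.trans (Finset.filter_subset _ _)) hc
          refine ⟨_, h, h', ?_⟩
          intro x hx y hy
          rcases Finset.mem_insert.1 hx with rfl | hx' <;>
            rcases Finset.mem_insert.1 hy with rfl | hy'
          · exact G.loopless.irrefl _
          · exact (Finset.mem_filter.1 (hT hy')).2
          · exact fun h => (Finset.mem_filter.1 (hT hx')).2 h.symm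
          · exact hadj x hx' y hy'

/-! ### Many vertices near the maximum degree -/

/-- After deleting at most `R * m` vertices, `R` vertices have degree within `s` of the maximum. -/
lemma exists_clustered_top_degrees {V : Type u} [DecidableEq V] (G : SimpleGraph V) (R s m : ℕ)
    (S : Finset V) (hS : R * (m + 1) ≤ S.card) (hdeg : ∀ x ∈ S, degreeInto G S x ≤ m * s) :
    ∃ S' ⊆ S, ∃ T ⊆ S', (S \ S').card ≤ R * m ∧ T.card = R ∧
      ∀ x ∈ S', ∀ t ∈ T, degreeInto G S' x ≤ degreeInto G S' t + s := by
  induction m generalizing S with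
  | zero =>
    obtain ⟨T, hT, hc⟩ := Finset.exists_subset_card_eq (show R ≤ S.card by simpa using hS)
    exact ⟨S, subset_rfl, T, hT, by simp, hc, fun x hx t _ => by have := hdeg x hx; omega⟩
  | succ m ih =>
    -- `A` is the top layer of width `s`: with `R` members it supplies `T`, otherwise deleting it
    -- costs fewer than `R` vertices.
    let A := S.filter fun x => m * s < degreeInto G S x
    by_cases hA : R ≤ A.card
    · obtain ⟨T, hT, hc⟩ := Finset.exists_subset_card_eq hA
      refine ⟨S, subset_rfl, T, hT.trans (Finset.filter_subset _ _), by simp, hc, ?_⟩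
      intro x hx t ht
      have h1 := (Finset.mem_filter.1 (hT ht)).2
      have h2 := hdeg x hx
      rw [Nat.succ_mul] at h2
      omega
    · have hAS : A ⊆ S := Finset.filter_subset _ _
      have hcard := Finset.card_sdiff_add_card_eq_card hAS
      obtain ⟨S', hS', T, hT, hc, hTc, h⟩ := ih (S \ A) (by nlinarith) (by
        intro x hx
        refine (degreeInto_mono G Finset.sdiff_subset x).trans ?_
        by_contra hlt
        exact (Finset.mem_sdiff.1 hx).2
          (Finset.mem_filter.2 ⟨(Finset.mem_sdiff.1 hx).1, by omega⟩))
      refine ⟨S', hS'.trans Finset.sdiff_subset, T, hT, ?_, hTc, h⟩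
      calc (S \ S').card ≤ (A ∪ ((S \ A) \ S')).card := Finset.card_le_card (by
            intro x; simp only [Finset.mem_sdiff, Finset.mem_union]; tauto)
        _ ≤ A.card + ((S \ A) \ S').card := Finset.card_union_le _ _
        _ ≤ R * (m + 1) := by nlinarith

/-- One step in enlarging a family of vertices of nearly maximum degree. -/
lemma exists_enlarged_near_max_family (j c p : ℕ) (hj : 1 ≤ j) : ∃ C, ∀ (V : Type u)
    [DecidableEq V] (G : SimpleGraph V) (S P : Finset V) (w : Fin j → V) (t : V) (L : ℕ),
    P ⊆ S → P.card ≤ p → Function.Injective w → (∀ i, w i ∈ P) → t ∈ P → t ∉ Set.range w →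
    (∀ x ∈ S, ∀ i, degreeInto G S x ≤ degreeInto G S (w i) + c) →
    (∀ x ∈ S, degreeInto G S x ≤ degreeInto G S t + L) →
    ∃ S' ⊆ S, P ⊆ S' ∧ (S \ S').card ≤ C * (L + 1) ∧
      ∃ w' : Fin (j + 1) → V, Function.Injective w' ∧ (∀ i, w' i ∈ S') ∧
        ∀ x ∈ S', ∀ i, degreeInto G S' x ≤ degreeInto G S' (w' i) + C := by
  obtain ⟨C, hC⟩ := exists_equalizing_deletion.{u} (j + 1)
  -- The first entry bounds the new slack below the maximum, the second the deletions per unit of `L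
  -- + 1`.
  refine ⟨max (C + c + 2 * p) (C * ((j + 1) * (j + 1) * (c + p + 1))), ?_⟩
  intro V _ G S P w t L hPS hPp hw hwP htP htw hmax htL
  have hP : ∀ v, degreeInto G P v ≤ p := fun v => (degreeInto_le_card G P v).trans hPp
  have hsplit : ∀ U : Finset V, Disjoint U P → ∀ v,
      degreeInto G (U ∪ P) v = degreeInto G U v + degreeInto G P v :=
    fun U hU v => degreeInto_union G hU v
  have hinj : ∀ x, x ∉ Set.range w → Function.Injective (Fin.cons x w : Fin (j + 1) → V) :=
    fun x hx => Fin.cons_injective_iff.2 ⟨hx, hw⟩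
  let i₀ : Fin j := ⟨0, hj⟩
  -- Only vertices outside `P` are deleted, so `w` and the reserves survive; ignoring edges into `P`
  -- costs at most `p` per degree. The invariant keeps every `w i` near the maximum.
  refine Exists.elim (hC V G (Fin.cons t w)
    (fun U => Disjoint U P ∧
      (∀ x ∈ U ∪ P, x ∉ Set.range w → x ≠ t →
        ∀ i, degreeInto G (U ∪ P) x ≤ degreeInto G (U ∪ P) (w i) + c) ∧
      ∀ a i, degreeInto G U ((Fin.cons t w : Fin (j + 1) → V) a) - degreeInto G U (w i) ≤ c + p)
    (fun U => ∃ w' : Fin (j + 1) → V, Function.Injective w' ∧ (∀ i, w' i ∈ U ∪ P) ∧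
        ∀ x ∈ U ∪ P, ∀ i, degreeInto G (U ∪ P) x ≤ degreeInto G (U ∪ P) (w' i) + (C + c + 2 * p))
    ?_ ?_ (S \ P) ?_) ?_
  · rintro U ⟨hUP, hout, hin⟩ heq
    refine ⟨Fin.cons t w, hinj t htw, ?_, ?_⟩
    · intro i
      refine Finset.mem_union_right _ (Fin.cases ?_ (fun i => ?_) i)
      · exact htP
      · exact hwP i
    · have hww : ∀ a b, degreeInto G (U ∪ P) ((Fin.cons t w : Fin (j + 1) → V) a) ≤
          degreeInto G (U ∪ P) ((Fin.cons t w : Fin (j + 1) → V) b) + p := by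
        intro a b
        rw [hsplit U hUP, hsplit U hUP, heq a b]
        have := hP ((Fin.cons t w : Fin (j + 1) → V) a)
        omega
      intro x hx a
      by_cases hxt : x = t
      · have := hww 0 a
        rw [Fin.cons_zero] at this
        subst hxt
        omega
      by_cases hxw : x ∈ Set.range w
      · obtain ⟨i, rfl⟩ := hxw
        have := hww i.succ a
        rw [Fin.cons_succ] at this
        omega
      · have h1 := hww i₀.succ a
        rw [Fin.cons_succ] at h1
        have h2 := hout x hx hxw hxt i₀
        omega
  · rintro U B hBU hBC ⟨hUP, hout, hin⟩ hshrink
    -- An outsider within `C` of some `w i` replaces `t` as the new member. Otherwise all outsiders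
    -- are more than `C` below, and deleting at most `C` vertices cannot lift one above a `w i`, so
    -- the slack `c` does not erode.
    by_cases hclose : ∃ x ∈ U ∪ P, x ∉ Set.range w ∧ x ≠ t ∧
        ∃ i, degreeInto G (U ∪ P) (w i) ≤ degreeInto G (U ∪ P) x + C
    · left
      obtain ⟨x₀, hx₀, hx₀w, hx₀t, i₁, hi₁⟩ := hclose
      have hmaxU : ∀ x ∈ U ∪ P, ∀ i, degreeInto G (U ∪ P) x ≤
          degreeInto G (U ∪ P) (w i) + (c + 2 * p) := by
        have hww : ∀ a i, degreeInto G (U ∪ P) ((Fin.cons t w : Fin (j + 1) → V) a) ≤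
            degreeInto G (U ∪ P) (w i) + (c + 2 * p) := by
          intro a i
          rw [hsplit U hUP, hsplit U hUP]
          have := hin a i
          have := hP ((Fin.cons t w : Fin (j + 1) → V) a)
          omega
        intro x hx i
        by_cases hxt : x = t
        · have := hww 0 i
          rwa [Fin.cons_zero, ← hxt] at this
        by_cases hxw : x ∈ Set.range w
        · obtain ⟨i', rfl⟩ := hxw
          exact hww i'.succ i
        · have := hout x hx hxw hxt i
          omega
      refine ⟨Fin.cons x₀ w, hinj x₀ hx₀w, ?_, ?_⟩
      · intro i
        refine Fin.cases ?_ (fun i => ?_) i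
        · exact hx₀
        · exact Finset.mem_union_right _ (hwP i)
      · intro x hx i
        refine Fin.cases ?_ (fun i => ?_) i
        · have := hmaxU x hx i₁
          rw [Fin.cons_zero]
          omega
        · have := hmaxU x hx i
          rw [Fin.cons_succ]
          omega
    · right
      push Not at hclose
      refine ⟨hUP.mono_left Finset.sdiff_subset, ?_, fun a i => (hshrink a i.succ).trans (hin a i)⟩
      have hB : (U ∪ P) \ B = U \ B ∪ P := by
        rw [Finset.union_sdiff_distrib,
          Finset.sdiff_eq_self_of_disjoint (hUP.mono_left hBU).symm]
      intro x hx hxw hxt i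
      rw [← hB] at hx ⊢
      have hBU' : B ⊆ U ∪ P := hBU.trans Finset.subset_union_left
      have h1 := hclose x (Finset.sdiff_subset hx) hxw hxt i
      have h2 := degreeInto_sdiff G hBU' x
      have h3 := degreeInto_sdiff G hBU' (w i)
      have h4 := degreeInto_le_card G B (w i)
      omega
  · refine ⟨Finset.sdiff_disjoint, ?_, ?_⟩
    · rw [Finset.sdiff_union_of_subset hPS]
      exact fun x hx _ _ i => hmax x hx i
    · intro a i
      have hmem : (Fin.cons t w : Fin (j + 1) → V) a ∈ S := by
        refine Fin.cases ?_ (fun i => ?_) a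
        · exact hPS htP
        · exact hPS (hwP i)
      have h1 := hmax _ hmem i
      have h2 := degreeInto_sdiff G hPS (w i)
      have h3 := hP (w i)
      have h4 := degreeInto_mono G (Finset.sdiff_subset (s := S) (t := P))
        ((Fin.cons t w : Fin (j + 1) → V) a)
      omega
  · rintro U' ⟨hU', ⟨w', hw'i, hw'm, hw'⟩, hcard⟩
    refine ⟨U' ∪ P, Finset.union_subset (hU'.trans Finset.sdiff_subset) hPS,
      Finset.subset_union_right, ?_, w', hw'i, hw'm,
      fun x hx i => (hw' x hx i).trans (Nat.add_le_add_left (le_max_left _ _) _)⟩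
    have hsum : ∑ q : Fin (j + 1) × Fin (j + 1),
        (degreeInto G (S \ P) ((Fin.cons t w : Fin (j + 1) → V) q.1) -
          degreeInto G (S \ P) ((Fin.cons t w : Fin (j + 1) → V) q.2)) ≤
        (j + 1) * (j + 1) * (c + p + L) := by
      refine (Finset.sum_le_card_nsmul _ _ (c + p + L) ?_).trans (by simp)
      intro q _
      have hS : ∀ v, degreeInto G (S \ P) v + degreeInto G P v = degreeInto G S v :=
        fun v => degreeInto_sdiff G hPS v
      have hmem : (Fin.cons t w : Fin (j + 1) → V) q.1 ∈ S := by
        refine Fin.cases ?_ (fun i => ?_) q.1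
        · exact hPS htP
        · exact hPS (hwP i)
      have hb : ∀ a, degreeInto G S ((Fin.cons t w : Fin (j + 1) → V) q.1) ≤
          degreeInto G S ((Fin.cons t w : Fin (j + 1) → V) a) + (c + L) := by
        intro a
        refine Fin.cases ?_ (fun i => ?_) a
        · have := htL _ hmem; simp only [Fin.cons_zero]; omega
        · have := hmax _ hmem i; simp only [Fin.cons_succ]; omega
      have := hb q.2
      have := hS ((Fin.cons t w : Fin (j + 1) → V) q.1)
      have := hS ((Fin.cons t w : Fin (j + 1) → V) q.2)
      have := hP ((Fin.cons t w : Fin (j + 1) → V) q.1)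
      have := hP ((Fin.cons t w : Fin (j + 1) → V) q.2)
      omega
    calc (S \ (U' ∪ P)).card ≤ ((S \ P) \ U').card := Finset.card_le_card (by
          intro x; simp only [Finset.mem_sdiff, Finset.mem_union]; tauto)
      _ ≤ C * ((j + 1) * (j + 1) * (c + p + L)) :=
          hcard.trans (Nat.mul_le_mul_left _ hsum)
      _ ≤ C * ((j + 1) * (j + 1) * ((c + p + 1) * (L + 1))) := by
          gcongr; nlinarith
      _ = C * ((j + 1) * (j + 1) * (c + p + 1)) * (L + 1) := by ring
      _ ≤ _ := by gcongr; exact le_max_right _ _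

/-- From `R` vertices of degree within `s` of the maximum to `j ≤ R` vertices of degree within a
constant of the maximum, at the cost of `O(s)` deletions. -/
lemma exists_near_max_family (R j : ℕ) (hj : 1 ≤ j) (hjR : j ≤ R) : ∃ c p K, ∀ (V : Type u)
    [DecidableEq V] (G : SimpleGraph V) (S₀ T₀ : Finset V) (s : ℕ), T₀ ⊆ S₀ → T₀.card = R →
    (∀ x ∈ S₀, ∀ t ∈ T₀, degreeInto G S₀ x ≤ degreeInto G S₀ t + s) →
    ∃ S ⊆ S₀, ∃ P ⊆ S, T₀ ⊆ P ∧ P.card ≤ p ∧ (S₀ \ S).card ≤ K * (s + 1) ∧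
      ∃ w : Fin j → V, Function.Injective w ∧ (∀ i, w i ∈ P) ∧
        ∀ x ∈ S, ∀ i, degreeInto G S x ≤ degreeInto G S (w i) + c := by
  induction j, hj using Nat.le_induction with
  | base =>
    refine ⟨0, R + 1, 0, fun V _ G S₀ T₀ s hT hc hs => ?_⟩
    have hne : S₀.Nonempty := (Finset.card_pos.1 (by omega : 0 < T₀.card)).mono hT
    obtain ⟨v, hv, hmax⟩ := Finset.exists_max_image S₀ (degreeInto G S₀) hne
    refine ⟨S₀, subset_rfl, insert v T₀, Finset.insert_subset hv hT, Finset.subset_insert _ _,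
      (Finset.card_insert_le _ _).trans (by omega), by simp, fun _ => v,
      Function.injective_of_subsingleton _, fun _ => Finset.mem_insert_self _ _,
      fun x hx _ => by simpa using hmax x hx⟩
  | succ j hj ih =>
    obtain ⟨c, p, K, h⟩ := ih (by omega)
    obtain ⟨C, hC⟩ := exists_enlarged_near_max_family.{u} j c p hj
    refine ⟨C, p + (j + 1), K + C * (K + 1), fun V _ G S₀ T₀ s hT hc hs => ?_⟩
    obtain ⟨S, hS, P, hPS, hTP, hPp, hcard, w, hw, hwP, hmax⟩ := h V G S₀ T₀ s hT hc hs
    -- Since `j < R`, some reserve is unused. It lags by at most `s` plus the number of earlier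
    -- deletions, which is the `L` used next.
    obtain ⟨t, ht, htw⟩ : ∃ t ∈ T₀, t ∉ Finset.univ.image w :=
      Finset.exists_mem_notMem_of_card_lt_card
        (Finset.card_image_le.trans_lt (by rw [Finset.card_univ, Fintype.card_fin]; omega))
    obtain ⟨S', hS', hPS', hcard', w', hw', hw'S, hmax'⟩ := hC V G S P w t (s + K * (s + 1)) hPS hPp
      hw hwP (hTP ht) (by simpa using htw) hmax (by
        intro x hx
        have h1 := degreeInto_mono G hS x
        have h2 := hs x (hS hx) t ht
        have h3 := degreeInto_le_sdiff_add G S₀ S t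
        omega)
    refine ⟨S', hS'.trans hS, P ∪ Finset.univ.image w', Finset.union_subset hPS' ?_,
      hTP.trans Finset.subset_union_left, ?_, ?_, w', hw', ?_, hmax'⟩
    · intro x hx
      obtain ⟨i, _, rfl⟩ := Finset.mem_image.1 hx
      exact hw'S i
    · refine (Finset.card_union_le _ _).trans (add_le_add hPp ?_)
      exact Finset.card_image_le.trans (by simp)
    · calc (S₀ \ S').card ≤ ((S₀ \ S) ∪ (S \ S')).card := Finset.card_le_card (by
            intro x; simp only [Finset.mem_sdiff, Finset.mem_union]; tauto)
        _ ≤ K * (s + 1) + C * (s + K * (s + 1) + 1) :=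
            (Finset.card_union_le _ _).trans (add_le_add hcard hcard')
        _ = _ := by ring
    · exact fun i => Finset.mem_union_right _ (Finset.mem_image_of_mem _ (Finset.mem_univ _))

/-! ### Exact equality and the final count -/

/-- Among sufficiently many vertices of degree within `c` of the maximum, `k` can be given equal
degrees by a bounded number of deletions. -/
lemma exists_equal_degrees_of_near_max (k : ℕ) : ∃ R, ∀ c, ∃ C, ∀ (V : Type u)
    [DecidableEq V] (G : SimpleGraph V) (S W : Finset V), W ⊆ S → R ≤ W.card →
    (∀ x ∈ S, ∀ y ∈ W, degreeInto G S x ≤ degreeInto G S y + c) →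
    ∃ S' ⊆ S, ∃ T ⊆ S', (S \ S').card ≤ C ∧ T.card = k ∧ ∃ d, (∀ v ∈ T, degreeInto G S' v = d) ∧
      ∀ x ∈ S', k ≠ 0 → degreeInto G S' x ≤ d + C := by
  classical
  obtain ⟨R, hR⟩ := exists_clique_or_indep.{u} k k
  obtain ⟨C, hC⟩ := exists_equalizing_deletion.{u} k
  refine ⟨R, fun c => ⟨c + C * (k * k * (c + k)), fun V _ G S W hWS hW hmax => ?_⟩⟩
  obtain ⟨T, hTW, hTk, e, hTe⟩ : ∃ T ⊆ W, T.card = k ∧ ∃ e, ∀ x ∈ T, degreeInto G T x = e := by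
    rcases hR V G W hW with ⟨T, hT, hc, h⟩ | ⟨T, hT, hc, h⟩
    · refine ⟨T, hT, hc, k - 1, fun x hx => ?_⟩
      have : T.filter (G.Adj x) = T.erase x := by
        ext y
        simp only [Finset.mem_filter, Finset.mem_erase]
        exact ⟨fun ⟨hy, hxy⟩ => ⟨hxy.ne', hy⟩, fun ⟨hne, hy⟩ => ⟨hy, h x hx y hy hne.symm⟩⟩
      rw [← hc, ← Finset.card_erase_of_mem hx, ← this]
      unfold degreeInto
      congr!
    · refine ⟨T, hT, hc, 0, fun x hx => ?_⟩
      exact Finset.card_eq_zero.2 (Finset.filter_eq_empty_iff.2 fun y hy => h x hx y hy)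
  have hTS : T ⊆ S := hTW.trans hWS
  let w : Fin k → V := fun i => (T.equivFinOfCardEq hTk).symm i
  have hwT : ∀ i, w i ∈ T := fun i => ((T.equivFinOfCardEq hTk).symm i).2
  have hws : ∀ v ∈ T, ∃ i, w i = v := fun v hv =>
    ⟨T.equivFinOfCardEq hTk ⟨v, hv⟩, by simp [w]⟩
  obtain ⟨U, hU, heq, hcard⟩ := hC V G w (fun _ => True)
    (fun U => ∀ a b, degreeInto G U (w a) = degreeInto G U (w b)) (fun _ _ h => h)
    (fun _ _ _ _ _ _ => Or.inr trivial) (S \ T) trivial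
  have hsum : ∑ q : Fin k × Fin k,
      (degreeInto G (S \ T) (w q.1) - degreeInto G (S \ T) (w q.2)) ≤ k * k * (c + k) := by
    refine (Finset.sum_le_card_nsmul _ _ (c + k) ?_).trans (by simp)
    intro q _
    have h1 := degreeInto_sdiff G hTS (w q.1)
    have h2 := degreeInto_sdiff G hTS (w q.2)
    have h3 := hmax _ (hTS (hwT q.1)) _ (hTW (hwT q.2))
    have h4 := degreeInto_le_card G T (w q.2)
    omega
  have hUT : Disjoint U T := Finset.disjoint_of_subset_left hU Finset.sdiff_disjoint
  have hdel : (S \ (U ∪ T)).card ≤ C * (k * k * (c + k)) :=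
    calc (S \ (U ∪ T)).card ≤ ((S \ T) \ U).card := Finset.card_le_card (by
          intro x; simp only [Finset.mem_sdiff, Finset.mem_union]; tauto)
      _ ≤ _ := hcard.trans (Nat.mul_le_mul_left _ hsum)
  have hS'S : U ∪ T ⊆ S := Finset.union_subset (hU.trans Finset.sdiff_subset) hTS
  refine ⟨U ∪ T, hS'S, T, Finset.subset_union_right, hdel.trans (Nat.le_add_left _ _), hTk, ?_⟩
  rcases Nat.eq_zero_or_pos k with hk | hk
  · rw [hk, Finset.card_eq_zero] at hTk
    exact ⟨0, by simp [hTk], fun _ _ h => absurd hk h⟩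
  let v := w ⟨0, hk⟩
  refine ⟨degreeInto G (U ∪ T) v, fun x hx => ?_, fun x hx _ => ?_⟩
  · obtain ⟨i, rfl⟩ := hws x hx
    rw [degreeInto_union G hUT, degreeInto_union G hUT, hTe _ hx, hTe _ (hwT _), heq]
  · have h1 := degreeInto_mono G hS'S x
    have h2 := hmax x (hS'S hx) v (hTW (hwT _))
    have h3 := degreeInto_le_sdiff_add G S (U ∪ T) v
    omega

lemma degree_induce_eq_degreeInto {V : Type u} (G : SimpleGraph V) (S : Finset V)
    (v : (S : Set V)) [Fintype ((G.induce (S : Set V)).neighborSet v)] :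
    (G.induce (S : Set V)).degree v = degreeInto G S v := by
  classical
  rw [← SimpleGraph.card_neighborFinset_eq_degree,
    ← Finset.card_map (Function.Embedding.subtype _)]
  unfold degreeInto
  congr 1
  ext y
  simp only [Finset.mem_map, SimpleGraph.mem_neighborFinset, Finset.mem_filter,
    SimpleGraph.comap_adj, Function.Embedding.subtype_apply]
  constructor
  · rintro ⟨y, hy, rfl⟩
    exact ⟨y.2, hy⟩
  · rintro ⟨hy, h⟩
    exact ⟨⟨y, hy⟩, h, rfl⟩

lemma degreeInto_univ {V : Type u} [Fintype V] (G : SimpleGraph V) [DecidableRel G.Adj] (v : V) :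
    degreeInto G Finset.univ v = G.degree v := by
  classical
  rw [← SimpleGraph.card_neighborFinset_eq_degree, SimpleGraph.neighborFinset_eq_filter]
  unfold degreeInto
  congr!

/-- Deleting `O(√Δ)` vertices gives `k` vertices of equal degree within a constant of the
maximum. -/
lemma exists_large_finset_equal_near_max_degrees (k : ℕ) (hk : 1 ≤ k) : ∃ K N, ∀ (V : Type u)
    [Fintype V] [DecidableEq V] (G : SimpleGraph V) (D : ℕ), N ≤ Fintype.card V → 1 ≤ D →
    D < Fintype.card V → (∀ x, degreeInto G Finset.univ x ≤ D) →
    ∃ S : Finset V, Fintype.card V ≤ S.card + K * Nat.sqrt D ∧ ∃ T ⊆ S, T.card = k ∧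
      ∃ d, (∀ v ∈ T, degreeInto G S v = d) ∧ ∀ x ∈ S, degreeInto G S x ≤ d + K := by
  obtain ⟨R₀, hR⟩ := exists_equal_degrees_of_near_max.{u} k
  set R := R₀ + 1
  obtain ⟨c, p, K, hK⟩ := exists_near_max_family.{u} R R (by omega) le_rfl
  obtain ⟨C, hC⟩ := hR c
  -- With `q ≥ 1`, the three stages cost at most `R * (q + 1)`, `K * (q + 2)` and `C`. The bound on
  -- `N` gives `R * (q + 2) ≤ n` for small `q`; for `q > 3 * R` it follows from `q * q ≤ D < n`.
  refine ⟨2 * R + 3 * K + C, (3 * R) * (3 * R), fun V _ _ G D hN hD hDn hdeg => ?_⟩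
  set q := Nat.sqrt D
  have hq1 : 1 ≤ q := Nat.le_sqrt.2 (by omega)
  have hqD : D < (q + 1) * (q + 1) := Nat.lt_succ_sqrt D
  have hqD' : q * q ≤ D := Nat.sqrt_le D
  obtain ⟨S₀, -, T₀, hT₀, hc₀, hT₀R, hs₀⟩ := exists_clustered_top_degrees G R (q + 1) (q + 1)
    Finset.univ (by
      rw [Finset.card_univ]
      by_cases h : q ≤ 3 * R
      · nlinarith
      · nlinarith) (fun x _ => (hdeg x).trans hqD.le)
  obtain ⟨S₁, hS₁, P, hP, -, -, hc₁, w, hw, hwP, hmax⟩ := hK V G S₀ T₀ (q + 1) hT₀ hT₀R hs₀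
  obtain ⟨S, hS, T, hT, hc₂, hTk, d, hd, hd'⟩ := hC V G S₁ (Finset.univ.image w) (by
      intro x hx
      obtain ⟨i, _, rfl⟩ := Finset.mem_image.1 hx
      exact hP (hwP i)) (by
      rw [Finset.card_image_of_injective _ hw, Finset.card_univ, Fintype.card_fin]
      omega) (by
      intro x hx y hy
      obtain ⟨i, _, rfl⟩ := Finset.mem_image.1 hy
      exact hmax x hx i)
  refine ⟨S, ?_, T, hT, hTk, d, hd, fun x hx => (hd' x hx (by omega)).trans (by omega)⟩
  have h0 := Finset.card_sdiff_add_card_eq_card (Finset.subset_univ S₀)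
  have h1 := Finset.card_sdiff_add_card_eq_card hS₁
  have h2 := Finset.card_sdiff_add_card_eq_card hS
  rw [Finset.card_univ] at h0
  nlinarith

theorem theorem1 (k : ℕ) (hk : 1 ≤ k) :
    ∃ (g₁ g₂ : ℝ) (N : ℕ),
      ∀ (V : Type*) [Fintype V] [DecidableEq V] (G : SimpleGraph V) [DecidableRel G.Adj],
        N ≤ Fintype.card V →
        ∃ S : Finset V,
          (Fintype.card V : ℝ) - g₁ * √(G.maxDegree : ℝ) ≤ (S.card : ℝ) ∧
          ∃ (T : Finset (S : Set V)) (d : ℕ),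
            T.card = k ∧
            (∀ v ∈ T, (G.induce (S : Set V)).degree v = d) ∧
            ((G.induce (S : Set V)).maxDegree : ℝ) - g₂ ≤ (d : ℝ) := by
  obtain ⟨K, N, h⟩ := exists_large_finset_equal_near_max_degrees k hk
  -- The `k` serves the edgeless case, where no deletion is allowed and any `k` vertices work.
  refine ⟨K, K, max N k, fun V _ _ G _ hN => ?_⟩
  obtain ⟨S, hS, T, hT, hTk, d, hd, hd'⟩ : ∃ S : Finset V,
      Fintype.card V ≤ S.card + K * Nat.sqrt G.maxDegree ∧ ∃ T ⊆ S, T.card = k ∧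
      ∃ d, (∀ v ∈ T, degreeInto G S v = d) ∧ ∀ x ∈ S, degreeInto G S x ≤ d + K := by
    have hcard : k ≤ Fintype.card V := (le_max_right _ _).trans hN
    rcases Nat.eq_zero_or_pos G.maxDegree with h0 | hpos
    · obtain ⟨T, hT, hTk⟩ := Finset.exists_subset_card_eq (s := (Finset.univ : Finset V))
        (n := k) (by rwa [Finset.card_univ])
      have hz : ∀ v, degreeInto G Finset.univ v = 0 := fun v => by
        have := G.degree_le_maxDegree v
        rw [degreeInto_univ]
        omega
      exact ⟨Finset.univ, by simp, T, hT, hTk, 0, fun v _ => hz v, fun v _ => by simp [hz v]⟩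
    · have : Nonempty V := Fintype.card_pos_iff.1 (by omega)
      exact h V G G.maxDegree ((le_max_left _ _).trans hN) hpos G.maxDegree_lt_card_verts
        fun x => by rw [degreeInto_univ]; exact G.degree_le_maxDegree x
  refine ⟨S, ?_, T.subtype (· ∈ (S : Set V)), d, ?_, ?_, ?_⟩
  · have h1 : (Fintype.card V : ℝ) ≤ S.card + K * Nat.sqrt G.maxDegree := by exact_mod_cast hS
    have h2 : (Nat.sqrt G.maxDegree : ℝ) ≤ √(G.maxDegree : ℝ) := Real.nat_sqrt_le_real_sqrt
    have h3 := mul_le_mul_of_nonneg_left h2 (Nat.cast_nonneg (α := ℝ) K)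
    linarith
  · rw [Finset.card_subtype, Finset.filter_true_of_mem (fun x hx => Finset.mem_coe.2 (hT hx)), hTk]
  · intro v hv
    rw [degree_induce_eq_degreeInto]
    exact hd v (Finset.mem_subtype.1 hv)
  · have hmax : (G.induce (S : Set V)).maxDegree ≤ d + K :=
      SimpleGraph.maxDegree_le_of_forall_degree_le _ _ fun v => by
        rw [degree_induce_eq_degreeInto]
        exact hd' v v.2
    have : ((G.induce (S : Set V)).maxDegree : ℝ) ≤ d + K := by exact_mod_cast hmax
    linarith
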